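/- **Setting.** For $d\in\mathbb N$ let $L_2^d$ be the real Hilbert space of square-integrable signals $[0,\infty)\to\mathbb R^d$, and $L_{2e}^d\supseteq L_2^d$ the space of signals $u$ with $P_Tu\in L_2^d$ for all $T\ge 0$, where $(P_Tu)(t)=u(t)$ for $t\le T$ and $(P_Tu)(t)=0$ for $t>T$. An operator $R:L_2^p\to L_2^q$ is *causal* if $P_TRu=P_TRP_Tu$ for all $u\in L_2^p$, $T\ge0$; it is then extended to $R:L_{2e}^p\to L_{2e}^q$ by $P_TRu:=P_TRP_Tu$. Its incremental gain is $\Gamma(R)=\sup_{u_1\ne u_2}\|Ru_1-Ru_2\|/\|u_1-u_2\|\in[0,\infty]$, and it is *incrementally stable* if $\Gamma(R)<\infty$. For a relation $R$ on a real Hilbert space and a set $U$ of inputs, $\mathrm{SRG}_U(R)\subseteq\mathbb C_\infty=\mathbb C\cup\{\infty\}$ is the set of all numbers $$\frac{\|y_1-y_2\|}{\|u_1-u_2\|}\,e^{\pm j\angle(u_1-u_2,\;y_1-y_2)},\qquad u_1\ne u_2\in U,\ y_i\in Ru_i,$$ where $\angle(u,y)=\arccos\frac{\langle u,y\rangle}{\|u\|\|y\|}$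 (together with $\infty$ if $R$ is multi-valued and $U$ has at least two elements). For $R:L_2^p\to L_2^q$ and any $n\ge\max\{p,q\}$ put $\mathrm{SRG}(R):=\mathrm{SRG}_{\iota_{n\leftarrow p}(L_2^p)}(\iota_{n\leftarrow q}R\,\pi_{p\leftarrow n})$, where $\iota_{n\leftarrow p}:L_2^p\to L_2^n$ appends $n-p$ zero channels and $\pi_{p\leftarrow n}:L_2^n\to L_2^p$ keeps the first $p$ channels. For $\mathcal C,\mathcal C_1,\mathcal C_2\subseteq\mathbb C_\infty$: the radius of $\mathcal C$ is $\inf\{\rho>0:\mathcal C\subseteq\{z\in\mathbb C:|z|\le \rho\}\}$ ($=\infty$ if there is no such $\rho$); $\mathcal C^{-1}$ is the image of $\mathcal C$ under $\rho e^{j\phi}\mapsto\rho^{-1}e^{j\phi}$, $0\leftrightarrow\infty$; $\mathrm{dist}(\mathcal C_1,\mathcal C_2)=\inf_{z_i\in\mathcal C_i}|z_1-z_2|$ with $|\infty-\infty|=0$ and $|z-\infty|=\infty$ for $z\in\mathbb C$. $\mathcal C$ has the *chord property* if for every finite $z\in\mathcal C$ the segment $[z,\bar z]$ is contained in $\mathcal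 C$. For $H_1:L_2^p\to L_2^q$ and $H_2:L_2^q\to L_2^p$ let $[H_1,H_2]:=(H_1^{-1}+H_2)^{-1}$ (as relations). It is *well-posed on $L_2$* if for all $u\in L_2^p$ there are unique $e\in L_2^p$, $y\in L_2^q$ with $e=u-H_2y$ and $y=H_1e$. For causal $H_1,H_2$, with extensions to the extended spaces, it is *well-posed on the extended spaces* if for all $u\in L_2^p$ there are unique $e\in L_{2e}^p$, $y\in L_{2e}^q$ with $e=u-H_2y$ and $y=H_1e$. **Theorem.** Let $H_1:L_2^p\to L_2^q$ and $H_2:L_2^q\to L_2^p$ be operators such that $\mathrm{SRG}(H_1)$ and $\mathrm{SRG}(H_2)$ have finite radius and at least one of them has the chord property. Let $r>0$ and suppose that $$\mathrm{dist}\bigl(\mathrm{SRG}(H_1)^{-1},\,-\tau\,\mathrm{SRG}(H_2)\bigr)\ge r\qquad\text{for all }\tau\in[0,1].$$ Then $[H_1,H_2]$ is well-posed on $L_2$, and it is (the graph of) an operator $L_2^p\to L_2^q$ which is incrementally stable with $\Gamma([H_1,H_2])\le 1/r$. Moreover, if $H_1$ and $H_2$ are causal, then $[H_1,H_2]$ is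 causal, and it is also well-posed on the extended spaces. -/

import Mathlib

open MeasureTheory Set
open scoped NNReal ENNReal

noncomputable section

namespace MimoSRG

/-! ## Signal spaces -/

/-- Lebesgue measure on the time axis `[0, ∞)`. -/
abbrev halfLine : Measure ℝ := volume.restrict (Ici (0 : ℝ))

/-- `ℝ^d` with its Euclidean norm. -/
abbrev Vec (d : ℕ) : Type := EuclideanSpace ℝ (Fin d)

/-- The real Hilbert space `L_2^d` of square-integrable signals `[0, ∞) → ℝ^d`. -/
abbrev L2 (d : ℕ) : Type := Lp (Vec d) 2 halfLine

/-- The extended space `L_{2e}^d`: signals whose truncations to `[0, T]` are square-integrable for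
every `T ≥ 0` (identified when equal almost everywhere). -/
def L2e (d : ℕ) : AddSubgroup (ℝ →ₘ[halfLine] Vec d) where
  carrier := {u | ∀ T : ℝ≥0, MemLp ((Iic (T : ℝ)).indicator u) 2 halfLine}
  zero_mem' := fun T => by
    refine (MemLp.zero (ε := Vec d)).ae_eq ?_
    filter_upwards [AEEqFun.coeFn_zero (μ := halfLine) (α := ℝ) (β := Vec d)] with t ht
    by_cases h : t ∈ Iic (T : ℝ) <;> simp [h, ht]
  add_mem' := fun {u v} hu hv T => by
    refine ((hu T).add (hv T)).ae_eq ?_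
    filter_upwards [AEEqFun.coeFn_add u v] with t ht
    by_cases h : t ∈ Iic (T : ℝ) <;> simp [h, ht]
  neg_mem' := fun {u} hu T => by
    refine (hu T).neg.ae_eq ?_
    filter_upwards [AEEqFun.coeFn_neg u] with t ht
    by_cases h : t ∈ Iic (T : ℝ) <;> simp [h, ht]

/-- The inclusion `L_2^d ⊆ L_{2e}^d`. -/
def toL2e {d : ℕ} (u : L2 d) : L2e d :=
  ⟨u.1, fun _ => (Lp.memLp u).indicator measurableSet_Iic⟩

/-- The truncation `P_T : L_2^d → L_2^d`. -/
def trunc {d : ℕ} (T : ℝ≥0) (u : L2 d) : L2 d :=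
  ((Lp.memLp u).indicator (measurableSet_Iic (a := (T : ℝ)))).toLp _

/-- The truncation `P_T : L_{2e}^d → L_2^d`. -/
def truncE {d : ℕ} (T : ℝ≥0) (u : L2e d) : L2 d := (u.2 T).toLp _

/-! ## Operators -/

/-- The incremental gain `Γ(R)`, with values in `[0, ∞]`. -/
def incGain {X Y : Type*} [NormedAddCommGroup X] [NormedAddCommGroup Y] (R : X → Y) : ℝ≥0∞ :=
  ⨆ (x₁ : X) (x₂ : X) (_ : x₁ ≠ x₂), ‖R x₁ - R x₂‖ₑ / ‖x₁ - x₂‖ₑ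

/-- An operator `R : L_2^p → L_2^q` is incrementally stable if `Γ(R) < ∞`. -/
def IncrementallyStable {p q : ℕ} (R : L2 p → L2 q) : Prop := incGain R < ⊤

/-- Causality on `L_2^p`: `P_T R u = P_T R P_T u` for all `u` and all `T ≥ 0`. -/
def Causal {p q : ℕ} (R : L2 p → L2 q) : Prop :=
  ∀ (T : ℝ≥0) (u : L2 p), trunc T (R u) = trunc T (R (trunc T u))

/-- The signal that on `[k, k + 1)` coincides with `R (P_{k+1} u)`, for every natural number `k`. -/
def glue {p q : ℕ} (R : L2 p → L2 q) (u : L2e p) (t : ℝ) : Vec q :=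
  R (truncE ((⌊t⌋₊ : ℝ≥0) + 1) u) t

theorem measurableSet_floor (k : ℕ) : MeasurableSet {t : ℝ | ⌊t⌋₊ = k} :=
  Nat.measurable_floor (measurableSet_singleton k)

theorem aestronglyMeasurable_glue {p q : ℕ} (R : L2 p → L2 q) (u : L2e p) :
    AEStronglyMeasurable (glue R u) halfLine := by
  have huniv : (⋃ k : ℕ, {t : ℝ | ⌊t⌋₊ = k}) = univ := by ext t; simp
  have key : AEStronglyMeasurable (glue R u)
      (halfLine.restrict (⋃ k : ℕ, {t : ℝ | ⌊t⌋₊ = k})) := by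
    rw [aestronglyMeasurable_iUnion_iff]
    intro k
    refine ((Lp.aestronglyMeasurable (R (truncE ((k : ℝ≥0) + 1) u))).restrict).congr ?_
    filter_upwards [ae_restrict_mem (measurableSet_floor k)] with t ht
    have ht' : ⌊t⌋₊ = k := ht
    simp only [glue, ht']
  rwa [huniv, Measure.restrict_univ] at key

theorem memLp_glue {p q : ℕ} (R : L2 p → L2 q) (u : L2e p) (T : ℝ≥0) :
    MemLp ((Iic (T : ℝ)).indicator (glue R u)) 2 halfLine := by
  have hsum : (Iic (T : ℝ)).indicator (glue R u) = fun t =>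
      ∑ k ∈ Finset.range (⌊(T : ℝ)⌋₊ + 1), (Iic (T : ℝ) ∩ {t : ℝ | ⌊t⌋₊ = k}).indicator
        (R (truncE ((k : ℝ≥0) + 1) u)) t := by
    funext t
    by_cases ht : t ≤ T
    · have hmem : ⌊t⌋₊ ∈ Finset.range (⌊(T : ℝ)⌋₊ + 1) :=
        Finset.mem_range.2 (Nat.lt_succ_of_le (Nat.floor_le_floor ht))
      rw [Finset.sum_eq_single_of_mem _ hmem]
      · simp [indicator, ht, glue]
      · intro k _ hk
        simp [indicator, hk.symm]
    · simp [indicator, ht]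
  rw [hsum]
  exact memLp_finsetSum _ fun k _ =>
    (Lp.memLp _).indicator (measurableSet_Iic.inter (measurableSet_floor k))

/-- The extension to `L_{2e}^p → L_{2e}^q` of a causal operator `R : L_2^p → L_2^q`; it is the
operator with `P_T (R u) = P_T (R (P_T u))`, see `truncE_causalExt`. -/
def causalExt {p q : ℕ} (R : L2 p → L2 q) (u : L2e p) : L2e q :=
  ⟨AEEqFun.mk (glue R u) (aestronglyMeasurable_glue R u), fun T => by
    refine (memLp_glue R u T).ae_eq ?_
    filter_upwards [AEEqFun.coeFn_mk (glue R u) (aestronglyMeasurable_glue R u)] with t ht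
    by_cases h : t ∈ Iic (T : ℝ) <;> simp [h, ht]⟩

theorem coeFn_trunc {d : ℕ} (T : ℝ≥0) (u : L2 d) :
    ∀ᵐ t ∂halfLine, trunc T u t = (Iic (T : ℝ)).indicator u t :=
  MemLp.coeFn_toLp _

theorem coeFn_truncE {d : ℕ} (T : ℝ≥0) (u : L2e d) :
    ∀ᵐ t ∂halfLine, truncE T u t = (Iic (T : ℝ)).indicator (u : ℝ →ₘ[halfLine] Vec d) t :=
  MemLp.coeFn_toLp _

theorem trunc_truncE {d : ℕ} {S T : ℝ≥0} (h : S ≤ T) (u : L2e d) :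
    trunc S (truncE T u) = truncE S u := by
  have h' : (S : ℝ) ≤ T := by exact_mod_cast h
  refine Lp.ext ?_
  filter_upwards [coeFn_trunc S (truncE T u), coeFn_truncE T u, coeFn_truncE S u] with t h1 h2 h3
  rw [h1, h3]
  by_cases ht : t ≤ S
  · have : t ≤ T := ht.trans h'
    simp [indicator, ht, h2, this]
  · simp [indicator, ht]

theorem truncE_causalExt {p q : ℕ} {R : L2 p → L2 q} (hR : Causal R) (T : ℝ≥0) (u : L2e p) :
    truncE T (causalExt R u) = trunc T (R (truncE T u)) := by
  have hk : ∀ k : ℕ, trunc (min T (k + 1)) (R (truncE ((k : ℝ≥0) + 1) u)) =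
      trunc (min T (k + 1)) (R (truncE T u)) := fun k => by
    rw [hR _ (truncE ((k : ℝ≥0) + 1) u), hR _ (truncE T u), trunc_truncE (min_le_right _ _),
      trunc_truncE (min_le_left _ _)]
  have hae : ∀ᵐ t ∂halfLine, ∀ k : ℕ, (Iic ((min T (k + 1) : ℝ≥0) : ℝ)).indicator
      (R (truncE ((k : ℝ≥0) + 1) u)) t =
      (Iic ((min T (k + 1) : ℝ≥0) : ℝ)).indicator (R (truncE T u)) t := by
    rw [ae_all_iff]
    intro k
    filter_upwards [coeFn_trunc (min T (k + 1)) (R (truncE ((k : ℝ≥0) + 1) u)),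
      coeFn_trunc (min T (k + 1)) (R (truncE T u))] with t h1 h2
    rw [← h1, ← h2, hk k]
  refine Lp.ext ?_
  filter_upwards [hae, coeFn_truncE T (causalExt R u), coeFn_trunc T (R (truncE T u)),
    AEEqFun.coeFn_mk (glue R u) (aestronglyMeasurable_glue R u)] with t h1 h2 h3 h4
  rw [h2, h3]
  by_cases ht : t ≤ T
  · have hle : t ≤ ((min T ((⌊t⌋₊ : ℝ≥0) + 1) : ℝ≥0) : ℝ) := by
      push_cast
      exact le_min ht (Nat.lt_floor_add_one t).le
    have := h1 ⌊t⌋₊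
    simp only [indicator, mem_Iic, hle, if_true] at this
    simp only [indicator, mem_Iic, ht, if_true]
    exact h4.trans this
  · simp [indicator, ht]

/-! ## Feedback interconnections -/

/-- The sum `R + S = {(x, y + z) | (x, y) ∈ R, (x, z) ∈ S}` of two relations. -/
def relAdd {X Y : Type*} [Add Y] (R S : SetRel X Y) : SetRel X Y :=
  {w | ∃ y z, (w.1, y) ∈ R ∧ (w.1, z) ∈ S ∧ w.2 = y + z}

/-- The feedback interconnection `[H₁, H₂] = (H₁⁻¹ + H₂)⁻¹`, a relation. -/
def feedback {X Y : Type*} [Add X] (H₁ : X → Y) (H₂ : Y → X) : SetRel X Y :=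
  (relAdd (Function.graph H₁).inv (Function.graph H₂)).inv

/-- For every `u ∈ D` there are unique `e` and `y` with `e = u - H₂ y` and `y = H₁ e`. -/
def WellPosedOn {X Y : Type*} [Sub X] (D : Set X) (H₁ : X → Y) (H₂ : Y → X) : Prop :=
  ∀ u ∈ D, ∃! ey : X × Y, ey.1 = u - H₂ ey.2 ∧ ey.2 = H₁ ey.1

/-! ## Subsets of the extended complex plane -/

/-- The distance on `ℂ ∪ {∞}`, with `|∞ - ∞| = 0` and `|z - ∞| = ∞` for finite `z`. -/
def extDist : OnePoint ℂ → OnePoint ℂ → ℝ≥0∞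
  | some z, some w => ‖z - w‖ₑ
  | none, none => 0
  | _, _ => ⊤

/-- The distance between two subsets of `ℂ ∪ {∞}`. -/
def setDist (A B : Set (OnePoint ℂ)) : ℝ≥0∞ := ⨅ z ∈ A, ⨅ w ∈ B, extDist z w

/-- The radius of a set: the infimum of all `r > 0` such that the closed disk of radius `r` centred
at the origin contains the set (`∞` if there is no such `r`). -/
def radius (C : Set (OnePoint ℂ)) : ℝ≥0∞ :=
  ⨅ (r : ℝ) (_ : 0 < r) (_ : C ⊆ (fun z : ℂ => (z : OnePoint ℂ)) '' Metric.closedBall 0 r),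
    ENNReal.ofReal r

open Classical in
/-- The inversion `ρ e^{jφ} ↦ ρ⁻¹ e^{jφ}` of `ℂ ∪ {∞}`, which exchanges `0` and `∞`. -/
def extInv : OnePoint ℂ → OnePoint ℂ
  | some z => if z = 0 then OnePoint.infty else (((starRingEnd ℂ z)⁻¹ : ℂ) : OnePoint ℂ)
  | none => ((0 : ℂ) : OnePoint ℂ)

/-- Multiplication by a real number `a` on `ℂ ∪ {∞}`, leaving `∞` fixed. -/
def extScale (a : ℝ) : OnePoint ℂ → OnePoint ℂ := OnePoint.map fun z => (a : ℂ) * z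

/-- The chord property: with `z` the set contains the segment from `z` to its conjugate. -/
def ChordProperty (C : Set (OnePoint ℂ)) : Prop :=
  ∀ z : ℂ, (z : OnePoint ℂ) ∈ C →
    ∀ w ∈ segment ℝ z (starRingEnd ℂ z), ((w : ℂ) : OnePoint ℂ) ∈ C

/-! ## Scaled relative graphs -/

section SRG

variable {H : Type*} [NormedAddCommGroup H] [InnerProductSpace ℝ H]

/-- The two numbers `(‖y‖ / ‖u‖) e^{± j ∠(u, y)}`. -/
def polarPair (u y : H) : Set ℂ :=
  {((‖y‖ / ‖u‖ : ℝ) : ℂ) * Complex.exp (Complex.I * (InnerProductGeometry.angle u y : ℝ)),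
   ((‖y‖ / ‖u‖ : ℝ) : ℂ) * Complex.exp (-(Complex.I * (InnerProductGeometry.angle u y : ℝ)))}

/-- A relation is multi-valued if some point is related to two distinct points. -/
def MultiValued (R : SetRel H H) : Prop :=
  ∃ u y y', (u, y) ∈ R ∧ (u, y') ∈ R ∧ y ≠ y'

/-- The set `z_R(u₁, u₂)`. -/
def zSet (R : SetRel H H) (u₁ u₂ : H) : Set (OnePoint ℂ) :=
  {z | ∃ y₁ y₂, (u₁, y₁) ∈ R ∧ (u₂, y₂) ∈ R ∧
    ∃ w ∈ polarPair (u₁ - u₂) (y₁ - y₂), z = (w : OnePoint ℂ)} ∪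
  {z | z = OnePoint.infty ∧ MultiValued R}

/-- The scaled relative graph of the relation `R` over the set `U` of inputs. -/
def srgOver (U : Set H) (R : SetRel H H) : Set (OnePoint ℂ) :=
  {z | ∃ u₁ ∈ U, ∃ u₂ ∈ U, u₁ ≠ u₂ ∧ z ∈ zSet R u₁ u₂}

end SRG

/-- The linear map `ℝ^m → ℝ^n` that keeps the first `min m n` coordinates and sets the remaining
ones to zero. -/
def resizeVec (m n : ℕ) : Vec m →L[ℝ] Vec n :=
  LinearMap.toContinuousLinearMap
    { toFun := fun x => WithLp.toLp 2 fun i : Fin n => if h : (i : ℕ) < m then x ⟨i, h⟩ else 0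
      map_add' := fun x y => by
        ext i
        by_cases h : (i : ℕ) < m <;> simp [h]
      map_smul' := fun c x => by
        ext i
        by_cases h : (i : ℕ) < m <;> simp [h] }

/-- The same on signals: `resize m n : L_2^m → L_2^n` is the embedding that appends zero channels
if `m ≤ n`, and the projection on the first `n` channels if `n ≤ m`. -/
def resize (m n : ℕ) : L2 m →L[ℝ] L2 n := (resizeVec m n).compLpL 2 halfLine

/-- The scaled relative graph of `R : L_2^p → L_2^q` (over all of `L_2^p`), computed after embedding
`R` in the operators on `L_2^n`, where `n ≥ max p q`. -/
def SRG (n : ℕ) {p q : ℕ} (R : L2 p → L2 q) : Set (OnePoint ℂ) :=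
  srgOver (range (resize p n)) (Function.graph fun u : L2 n => resize q n (R (resize n p u)))

end MimoSRG

end

/-! Write `K = H₂ ∘ H₁`. Everything reduces to inverting `I + K` on `L_2^p`, since the closed loop
is `H₁ ∘ (I + K)⁻¹`.

Separation of the graphs gives one estimate, uniform in `τ ∈ [0, 1]`: `r ‖H₁ x - H₁ y‖ ≤ ‖(x + τ K
x) - (y + τ K y)‖` (`mul_norm_sub_le_of_le_setDist`). Its core is planar: for increments `a, b, c`
of input, output and feedback, the angle between `a` and `c` is at most `∠(a,b) + ∠(b,c)`. Opening
it to that sum can only shorten `a + τ c`, and the opened configuration is a pair of points of the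
two graphs.

Finite radius makes `H₁` and `H₂` Lipschitz, so the estimate also bounds `(I + τK)⁻¹` by a constant
independent of `τ`. The continuity method then carries surjectivity from `τ = 0` to `τ = 1` in steps
of fixed length, each by Banach's fixed point theorem. The same induction carries the statement that
`P_T (x + τ K x)` determines `P_T x`, which yields causality and uniqueness on the extended spaces.
-/

namespace MimoSRG

/-! ### Angles and the planar comparison. -/

section Geometry

variable {H : Type*} [NormedAddCommGroup H] [InnerProductSpace ℝ H]

theorem cos_angle_add_angle_le (a b c : H) :
    Real.cos (InnerProductGeometry.angle a b + InnerProductGeometry.angle b c) ≤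
      Real.cos (InnerProductGeometry.angle a c) := by
  have h1 := InnerProductGeometry.angle_le_angle_add_angle a b c
  -- Reflecting `a` and `c` gives `∠(a,c) ≤ 2π - (∠(a,b) + ∠(b,c))`, needed once the sum exceeds
  -- `π`.
  have h2 := InnerProductGeometry.angle_le_angle_add_angle (-a) b (-c)
  rw [InnerProductGeometry.angle_neg_neg, InnerProductGeometry.angle_neg_left,
    InnerProductGeometry.angle_neg_right] at h2
  have h0 := InnerProductGeometry.angle_nonneg a c
  have hπ := InnerProductGeometry.angle_le_pi a c
  rcases le_total (InnerProductGeometry.angle a b + InnerProductGeometry.angle b c) Real.pi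
    with h | h
  · exact Real.cos_le_cos_of_nonneg_of_le_pi h0 h h1
  · rw [← Real.cos_two_pi_sub (InnerProductGeometry.angle a b + _)]
    exact Real.cos_le_cos_of_nonneg_of_le_pi h0 (by linarith) (by linarith)

theorem normSq_polar_add (s t θ φ : ℝ) :
    ‖(s : ℂ) * Complex.exp (Complex.I * (θ : ℝ)) +
      (t : ℂ) * Complex.exp (-(Complex.I * (φ : ℝ)))‖ ^ 2 =
      s ^ 2 + t ^ 2 + 2 * s * t * Real.cos (θ + φ) := by
  rw [mul_comm Complex.I, mul_comm Complex.I, ← neg_mul, ← Complex.ofReal_neg,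
    Complex.exp_mul_I, Complex.exp_mul_I, ← Complex.normSq_eq_norm_sq, Complex.normSq_apply]
  simp only [← Complex.ofReal_cos, ← Complex.ofReal_sin, Complex.add_re, Complex.add_im,
    Complex.mul_re, Complex.mul_im, Complex.ofReal_re, Complex.ofReal_im, Complex.I_re,
    Complex.I_im, Real.cos_neg, Real.sin_neg, Real.cos_add]
  linear_combination s ^ 2 * Real.sin_sq_add_cos_sq θ + t ^ 2 * Real.sin_sq_add_cos_sq φ

/-- Law of cosines on both sides: the lengths agree after scaling by `‖b‖`, and
`cos_angle_add_angle_le` compares the cross terms. Opposite signs of the arguments make the angles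
add. -/
theorem norm_polar_add_mul_le {a b c : H} (hb : b ≠ 0) {τ : ℝ} (hτ : 0 ≤ τ) :
    ‖((‖a‖ / ‖b‖ : ℝ) : ℂ) * Complex.exp (Complex.I * (InnerProductGeometry.angle a b : ℝ)) +
      ((τ * (‖c‖ / ‖b‖) : ℝ) : ℂ) *
        Complex.exp (-(Complex.I * (InnerProductGeometry.angle b c : ℝ)))‖ * ‖b‖ ≤
      ‖a + τ • c‖ := by
  have hb' : ‖b‖ ≠ 0 := norm_ne_zero_iff.2 hb
  refine le_of_sq_le_sq ?_ (norm_nonneg _)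
  rw [mul_pow, normSq_polar_add, norm_add_sq_real, norm_smul, inner_smul_right,
    ← InnerProductGeometry.cos_angle_mul_norm_mul_norm, Real.norm_of_nonneg hτ]
  have h := mul_le_mul_of_nonneg_left (cos_angle_add_angle_le a b c)
    (show 0 ≤ 2 * τ * ‖a‖ * ‖c‖ by positivity)
  have e : ((‖a‖ / ‖b‖) ^ 2 + (τ * (‖c‖ / ‖b‖)) ^ 2 + 2 * (‖a‖ / ‖b‖) * (τ * (‖c‖ / ‖b‖)) *
      Real.cos (InnerProductGeometry.angle a b + InnerProductGeometry.angle b c)) * ‖b‖ ^ 2 =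
      ‖a‖ ^ 2 + (τ * ‖c‖) ^ 2 + 2 * τ * ‖a‖ * ‖c‖ *
      Real.cos (InnerProductGeometry.angle a b + InnerProductGeometry.angle b c) := by
    field_simp
  rw [e]
  linarith

theorem extInv_polar {s : ℝ} (hs : s ≠ 0) (θ : ℝ) :
    extInv (((s : ℂ) * Complex.exp (Complex.I * (θ : ℝ)) : ℂ) : OnePoint ℂ) =
      (((s⁻¹ : ℝ) : ℂ) * Complex.exp (Complex.I * (θ : ℝ)) : ℂ) := by
  have h0 : (s : ℂ) * Complex.exp (Complex.I * (θ : ℝ)) ≠ 0 :=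
    mul_ne_zero (Complex.ofReal_ne_zero.2 hs) (Complex.exp_ne_zero _)
  change (if _ then _ else _) = _
  rw [if_neg h0]
  congr 1
  rw [map_mul, Complex.conj_ofReal, ← Complex.exp_conj, map_mul, Complex.conj_I,
    Complex.conj_ofReal, mul_inv, ← Complex.exp_neg, Complex.ofReal_inv]
  simp

end Geometry

/-! ### Continuity method for `I + τK`. -/

section Homotopy

variable {X : Type*} [NormedAddCommGroup X] [NormedSpace ℝ X]

/-- A solution of `x + τ K x = u` is a fixed point of `x ↦ (I + σK)⁻¹(u - (τ - σ) K x)`, a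
contraction by `hstep`. -/
theorem surjective_add_smul_of_step [CompleteSpace X] {K : X → X} {L C σ τ : ℝ}
    (hC : 0 ≤ C) (hK : ∀ x y, ‖K x - K y‖ ≤ L * ‖x - y‖)
    (hinv : ∀ x y, ‖x - y‖ ≤ C * ‖(x + σ • K x) - (y + σ • K y)‖)
    (hstep : C * |τ - σ| * L < 1)
    (hsurj : Function.Surjective fun x => x + σ • K x) :
    Function.Surjective fun x => x + τ • K x := by
  intro u
  choose G hG using hsurj
  simp only at hG
  have hlip : LipschitzWith (C * |τ - σ| * L).toNNReal fun x => G (u - (τ - σ) • K x) := by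
    refine LipschitzWith.of_dist_le_mul fun x y => ?_
    rw [dist_eq_norm, dist_eq_norm]
    refine (hinv _ _).trans ?_
    rw [hG, hG, sub_sub_sub_cancel_left, ← smul_sub, norm_smul, Real.norm_eq_abs, norm_sub_rev x]
    calc C * (|τ - σ| * ‖K y - K x‖) ≤ C * (|τ - σ| * (L * ‖y - x‖)) := by gcongr; exact hK y x
      _ = C * |τ - σ| * L * ‖y - x‖ := by ring
      _ ≤ _ := by gcongr; exact Real.le_coe_toNNReal _
  have hcontr : ContractingWith (C * |τ - σ| * L).toNNReal fun x => G (u - (τ - σ) • K x) :=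
    ⟨by simpa using hstep, hlip⟩
  refine ⟨hcontr.fixedPoint, ?_⟩
  have hfix : G (u - (τ - σ) • K hcontr.fixedPoint) = hcontr.fixedPoint :=
    hcontr.fixedPoint_isFixedPt
  have h := hG (u - (τ - σ) • K hcontr.fixedPoint)
  rw [hfix] at h
  calc _ = (hcontr.fixedPoint + σ • K hcontr.fixedPoint) + (τ - σ) • K hcontr.fixedPoint := by
        module
    _ = u := by rw [h]; abel

/-- Causality of `(I + τK)⁻¹` is inherited from that of `(I + σK)⁻¹`: `‖P x - P y‖` turns out to be
at most `C |τ - σ| L < 1` times itself. -/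
theorem proj_injective_add_smul_of_step {K : X → X} {P : X →ₗ[ℝ] X} {L C σ τ : ℝ}
    (hC : 0 ≤ C) (hP : ∀ x, ‖P x‖ ≤ ‖x‖) (hPP : ∀ x, P (P x) = P x)
    (hPK : ∀ x, P (K x) = P (K (P x)))
    (hK : ∀ x y, ‖K x - K y‖ ≤ L * ‖x - y‖)
    (hinv : ∀ x y, ‖x - y‖ ≤ C * ‖(x + σ • K x) - (y + σ • K y)‖)
    (hstep : C * |τ - σ| * L < 1)
    (hsurj : Function.Surjective fun x => x + σ • K x)
    (hcaus : ∀ x y, P (x + σ • K x) = P (y + σ • K y) → P x = P y)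
    {x y : X} (hxy : P (x + τ • K x) = P (y + τ • K y)) : P x = P y := by
  -- `hinv` controls only untruncated data, so `x` and `y` are replaced by solutions with truncated
  -- data and the same projections.
  obtain ⟨x', hx'⟩ := hsurj (P (x + σ • K x))
  obtain ⟨y', hy'⟩ := hsurj (P (y + σ • K y))
  simp only at hx' hy'
  have hx : P x = P x' := hcaus _ _ (by rw [hx', hPP])
  have hy : P y = P y' := hcaus _ _ (by rw [hy', hPP])
  have hPKL : ‖P (K x) - P (K y)‖ ≤ L * ‖P x - P y‖ := by
    rw [hPK x, hPK y, ← map_sub]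
    exact (hP _).trans (hK _ _)
  have hdiff : P (x + σ • K x) - P (y + σ • K y) = -((τ - σ) • (P (K x) - P (K y))) := by
    simp only [map_add, map_smul] at hxy ⊢
    linear_combination (norm := module) hxy
  have hle : ‖P x - P y‖ ≤ C * |τ - σ| * L * ‖P x - P y‖ :=
    calc ‖P x - P y‖ = ‖P (x' - y')‖ := by rw [hx, hy, map_sub]
      _ ≤ ‖x' - y'‖ := hP _
      _ ≤ C * ‖P (x + σ • K x) - P (y + σ • K y)‖ := by
        have := hinv x' y'
        rwa [hx', hy'] at this
      _ = C * (|τ - σ| * ‖P (K x) - P (K y)‖) := by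
        rw [hdiff, norm_neg, norm_smul, Real.norm_eq_abs]
      _ ≤ C * (|τ - σ| * (L * ‖P x - P y‖)) := by gcongr
      _ = _ := by ring
  have h0 : ‖P x - P y‖ = 0 := by nlinarith [norm_nonneg (P x - P y)]
  exact sub_eq_zero.1 (norm_eq_zero.1 h0)

/-- A property of `τ ∈ [0, 1]` that holds at `0` and propagates over small steps holds at `1`. -/
theorem of_small_steps {Q : ℝ → Prop} {δ : ℝ} (hδ : 0 < δ) (h0 : Q 0)
    (hstep : ∀ σ τ, 0 ≤ σ → σ ≤ 1 → |τ - σ| ≤ δ → Q σ → Q τ) : Q 1 := by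
  obtain ⟨N, hN⟩ := exists_nat_one_div_lt hδ
  have hN0 : (0 : ℝ) < N + 1 := by positivity
  have key : ∀ k : ℕ, k ≤ N + 1 → Q (k / (N + 1 : ℝ)) := by
    intro k
    induction k with
    | zero => intro _; simpa using h0
    | succ k ih =>
      intro hk
      have hk' : (k : ℝ) ≤ N + 1 := by exact_mod_cast (Nat.le_succ k).trans hk
      refine hstep (k / (N + 1 : ℝ)) _ (by positivity) ((div_le_one hN0).2 hk') ?_ (ih (by omega))
      rw [← sub_div, Nat.cast_succ, add_sub_cancel_left, abs_of_pos (by positivity)]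
      exact hN.le
  have := key (N + 1) le_rfl
  rwa [Nat.cast_succ, div_self hN0.ne'] at this

theorem exists_small_step {L C : ℝ} (hC : 0 ≤ C) (hL : 0 ≤ L) :
    ∃ δ > 0, ∀ s : ℝ, |s| ≤ δ → C * |s| * L < 1 := by
  have hCL : 0 < C * L + 1 := by positivity
  -- The added `1` keeps `δ` defined when `C * L = 0` and the inequality strict.
  refine ⟨(C * L + 1)⁻¹, inv_pos.2 hCL, fun s hs => ?_⟩
  calc C * |s| * L = C * L * |s| := by ring
    _ ≤ C * L * (C * L + 1)⁻¹ := by gcongr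
    _ < 1 := by rw [← div_eq_mul_inv, div_lt_one hCL]; linarith

theorem surjective_add_of_homotopy [CompleteSpace X] {K : X → X} {L C : ℝ}
    (hC : 0 ≤ C) (hL : 0 ≤ L) (hK : ∀ x y, ‖K x - K y‖ ≤ L * ‖x - y‖)
    (hinv : ∀ τ : ℝ, 0 ≤ τ → τ ≤ 1 → ∀ x y,
      ‖x - y‖ ≤ C * ‖(x + τ • K x) - (y + τ • K y)‖) :
    Function.Surjective fun x => x + (1 : ℝ) • K x := by
  obtain ⟨δ, hδ, hs⟩ := exists_small_step hC hL
  refine of_small_steps (Q := fun τ => Function.Surjective fun x => x + τ • K x) hδ ?_ ?_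
  · intro u
    exact ⟨u, by simp⟩
  · intro σ τ h0 h1 hστ hσ
    exact surjective_add_smul_of_step hC hK (hinv σ h0 h1) (hs _ hστ) hσ

theorem proj_injective_add_of_homotopy [CompleteSpace X] {K : X → X} {P : X →ₗ[ℝ] X} {L C : ℝ}
    (hC : 0 ≤ C) (hL : 0 ≤ L) (hP : ∀ x, ‖P x‖ ≤ ‖x‖) (hPP : ∀ x, P (P x) = P x)
    (hPK : ∀ x, P (K x) = P (K (P x)))
    (hK : ∀ x y, ‖K x - K y‖ ≤ L * ‖x - y‖)
    (hinv : ∀ τ : ℝ, 0 ≤ τ → τ ≤ 1 → ∀ x y,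
      ‖x - y‖ ≤ C * ‖(x + τ • K x) - (y + τ • K y)‖)
    {x y : X} (hxy : P (x + K x) = P (y + K y)) : P x = P y := by
  obtain ⟨δ, hδ, hs⟩ := exists_small_step hC hL
  -- Surjectivity travels along because the causality step solves the equation at `σ`.
  refine (of_small_steps (Q := fun τ => (Function.Surjective fun x => x + τ • K x) ∧
    ∀ x y, P (x + τ • K x) = P (y + τ • K y) → P x = P y) hδ ?_ ?_).2 x y (by simpa using hxy)
  · exact ⟨fun u => ⟨u, by simp⟩, fun x y h => by simpa using h⟩
  · rintro σ τ h0 h1 hστ ⟨hσ, hcaus⟩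
    exact ⟨surjective_add_smul_of_step hC hK (hinv σ h0 h1) (hs _ hστ) hσ, fun x y hxy =>
      proj_injective_add_smul_of_step hC hP hPP hPK hK (hinv σ h0 h1) (hs _ hστ) hσ hcaus hxy⟩

end Homotopy


/-! ### Zero-padding, and estimates read off from the scaled relative graphs. -/

section Resize

theorem coeFn_resize (m n : ℕ) (u : L2 m) :
    ∀ᵐ t ∂halfLine, resize m n u t = resizeVec m n (u t) :=
  (resizeVec m n).coeFn_compLp u

theorem resizeVec_apply (m n : ℕ) (x : Vec m) (i : Fin n) :
    resizeVec m n x i = if h : (i : ℕ) < m then x ⟨i, h⟩ else 0 := rfl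

theorem resizeVec_resizeVec {m n : ℕ} (h : m ≤ n) (x : Vec m) :
    resizeVec n m (resizeVec m n x) = x := by
  ext i
  simp [resizeVec_apply, i.2.trans_le h]

theorem norm_resizeVec {m n : ℕ} (h : m ≤ n) (x : Vec m) : ‖resizeVec m n x‖ = ‖x‖ := by
  obtain ⟨k, rfl⟩ := Nat.exists_eq_add_of_le h
  rw [EuclideanSpace.norm_eq, EuclideanSpace.norm_eq, Fin.sum_univ_add]
  simp [resizeVec_apply]

theorem resize_resize {m n : ℕ} (h : m ≤ n) (u : L2 m) : resize n m (resize m n u) = u := by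
  refine Lp.ext ?_
  filter_upwards [coeFn_resize n m (resize m n u), coeFn_resize m n u] with t h1 h2
  rw [h1, h2, resizeVec_resizeVec h]

theorem norm_resize {m n : ℕ} (h : m ≤ n) (u : L2 m) : ‖resize m n u‖ = ‖u‖ := by
  rw [Lp.norm_def, Lp.norm_def]
  congr 1
  refine eLpNorm_congr_norm_ae ?_
  filter_upwards [coeFn_resize m n u] with t ht
  rw [ht, norm_resizeVec h]

theorem mem_SRG {p q n : ℕ} (hp : p ≤ n) (R : L2 p → L2 q) {u₁ u₂ : L2 p} (hu : u₁ ≠ u₂) {w : ℂ}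
    (hw : w ∈ polarPair (resize p n (u₁ - u₂)) (resize q n (R u₁ - R u₂))) :
    (w : OnePoint ℂ) ∈ SRG n R := by
  refine ⟨resize p n u₁, mem_range_self _, resize p n u₂, mem_range_self _, ?_, Or.inl
    ⟨resize q n (R u₁), resize q n (R u₂), ?_, ?_, w, ?_, rfl⟩⟩
  · intro h
    exact hu (by rw [← resize_resize hp u₁, h, resize_resize hp])
  · simp [Function.graph, resize_resize hp]
  · simp [Function.graph, resize_resize hp]
  · rwa [← map_sub, ← map_sub]

theorem exists_lipschitz_of_radius_lt_top {p q n : ℕ} (hp : p ≤ n) (hq : q ≤ n) {R : L2 p → L2 q}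
    (h : radius (SRG n R) < ⊤) :
    ∃ L : ℝ, 0 ≤ L ∧ ∀ x y, ‖R x - R y‖ ≤ L * ‖x - y‖ := by
  simp only [radius, iInf_lt_iff] at h
  obtain ⟨L, hL, hsub, -⟩ := h
  refine ⟨L, hL.le, fun x y => ?_⟩
  rcases eq_or_ne x y with rfl | hxy
  · simp
  obtain ⟨w, hw, hw'⟩ := hsub (mem_SRG hp R hxy (Or.inl rfl))
  rw [OnePoint.coe_injective hw', mem_closedBall_zero_iff, norm_mul, mul_comm Complex.I,
    Complex.norm_exp_ofReal_mul_I, mul_one, Complex.norm_real, norm_resize hp, norm_resize hq,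
    Real.norm_of_nonneg (by positivity), div_le_iff₀ (norm_pos_iff.2 (sub_ne_zero.2 hxy))] at hw
  exact hw

/-- The incremental small-gain estimate contained in the separation of the scaled relative
graphs. -/
theorem mul_norm_sub_le_of_le_setDist {p q n : ℕ} (hp : p ≤ n) (hq : q ≤ n)
    {H₁ : L2 p → L2 q} {H₂ : L2 q → L2 p} {r τ : ℝ} (hτ : 0 ≤ τ)
    (hsep : ENNReal.ofReal r ≤ setDist (extInv '' SRG n H₁) (extScale (-τ) '' SRG n H₂))
    (x y : L2 p) :
    r * ‖H₁ x - H₁ y‖ ≤ ‖(x + τ • H₂ (H₁ x)) - (y + τ • H₂ (H₁ y))‖ := by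
  -- Equal outputs give no point in the graph of `H₂`, but then the left side vanishes.
  rcases eq_or_ne (H₁ x) (H₁ y) with hH | hH
  · simp [hH]
  have hxy : x ≠ y := fun h => hH (by rw [h])
  set a := resize p n (x - y) with ha
  set b := resize q n (H₁ x - H₁ y) with hb
  set c := resize p n (H₂ (H₁ x) - H₂ (H₁ y)) with hc
  have ha0 : ‖a‖ ≠ 0 := by rw [norm_resize hp]; exact norm_ne_zero_iff.2 (sub_ne_zero.2 hxy)
  have hb0 : ‖b‖ ≠ 0 := by rw [norm_resize hq]; exact norm_ne_zero_iff.2 (sub_ne_zero.2 hH)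
  -- The conjugates are chosen with opposite signs, `+` for `H₁` and `-` for `H₂`.
  have h1 := mem_image_of_mem extInv (mem_SRG (n := n) hp H₁ hxy (Or.inl rfl))
  have h2 := mem_image_of_mem (extScale (-τ)) (mem_SRG (n := n) hq H₂ hH (Or.inr rfl))
  rw [extInv_polar (div_ne_zero hb0 ha0), inv_div] at h1
  have h3 := hsep.trans ((iInf₂_le _ h1).trans (iInf₂_le _ h2))
  change ENNReal.ofReal r ≤ ‖_ - _‖ₑ at h3
  rw [← ofReal_norm, ENNReal.ofReal_le_ofReal_iff (norm_nonneg _)] at h3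
  beta_reduce at h3
  rw [Complex.ofReal_neg, neg_mul,
    sub_neg_eq_add, ← mul_assoc, ← Complex.ofReal_mul] at h3
  calc r * ‖H₁ x - H₁ y‖ = r * ‖b‖ := by rw [hb, norm_resize hq]
    _ ≤ _ := mul_le_mul_of_nonneg_right h3 (norm_nonneg _)
    _ ≤ ‖a + τ • c‖ := norm_polar_add_mul_le (norm_ne_zero_iff.1 hb0) hτ
    _ = ‖(x - y) + τ • (H₂ (H₁ x) - H₂ (H₁ y))‖ := by
      rw [ha, hc, ← map_smul, ← map_add, norm_resize hp]
    _ = _ := by congr 1; module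

end Resize

/-! ### Truncations and causal extensions. -/

section Truncation

/-- The truncation `P_T` as a linear map. -/
noncomputable def truncₗ {d : ℕ} (T : ℝ≥0) : L2 d →ₗ[ℝ] L2 d where
  toFun := trunc T
  map_add' u v := by
    refine Lp.ext ?_
    filter_upwards [coeFn_trunc T (u + v), coeFn_trunc T u, coeFn_trunc T v, Lp.coeFn_add u v,
      Lp.coeFn_add (trunc T u) (trunc T v)] with t h1 h2 h3 h4 h5
    rw [h1, h5, Pi.add_apply, h2, h3, ← Pi.add_apply, ← indicator_add']
    by_cases ht : t ∈ Iic (T : ℝ)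
    · rw [indicator_of_mem ht, indicator_of_mem ht, h4]
    · rw [indicator_of_notMem ht, indicator_of_notMem ht]
  map_smul' c u := by
    refine Lp.ext ?_
    filter_upwards [coeFn_trunc T (c • u), coeFn_trunc T u, Lp.coeFn_smul c u,
      Lp.coeFn_smul c (trunc T u)] with t h1 h2 h3 h4
    rw [h1, RingHom.id_apply, h4, Pi.smul_apply, h2]
    by_cases ht : t ∈ Iic (T : ℝ)
    · rw [indicator_of_mem ht, indicator_of_mem ht, h3, Pi.smul_apply]
    · rw [indicator_of_notMem ht, indicator_of_notMem ht, smul_zero]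

theorem norm_trunc_le {d : ℕ} (T : ℝ≥0) (u : L2 d) : ‖trunc T u‖ ≤ ‖u‖ := by
  refine Lp.norm_le_norm_of_ae_le ?_
  filter_upwards [coeFn_trunc T u] with t ht
  rw [ht]
  exact norm_indicator_le_norm_self _ _

theorem trunc_trunc {d : ℕ} (T : ℝ≥0) (u : L2 d) : trunc T (trunc T u) = trunc T u := by
  refine Lp.ext ?_
  filter_upwards [coeFn_trunc T (trunc T u), coeFn_trunc T u] with t h1 h2
  rw [h1]
  by_cases ht : t ∈ Iic (T : ℝ) <;> simp [ht, h2]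

theorem truncE_toL2e {d : ℕ} (T : ℝ≥0) (u : L2 d) : truncE T (toL2e u) = trunc T u := rfl

theorem truncE_sub {d : ℕ} (T : ℝ≥0) (u v : L2e d) :
    truncE T (u - v) = truncE T u - truncE T v := by
  refine Lp.ext ?_
  filter_upwards [coeFn_truncE T (u - v), coeFn_truncE T u, coeFn_truncE T v,
    AEEqFun.coeFn_sub u.1 v.1, Lp.coeFn_sub (truncE T u) (truncE T v)] with t h1 h2 h3 h4 h5
  rw [h1, h5, Pi.sub_apply, h2, h3]
  by_cases ht : t ∈ Iic (T : ℝ) <;> simp [ht, h4]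

theorem L2e_ext {d : ℕ} {u v : L2e d} (h : ∀ T, truncE T u = truncE T v) : u = v := by
  refine Subtype.ext (AEEqFun.ext ?_)
  -- Integer horizons suffice, and being countable they share one null set.
  have hu : ∀ᵐ t ∂halfLine, ∀ k : ℕ, truncE k u t = (Iic ((k : ℝ≥0) : ℝ)).indicator u.1 t :=
    ae_all_iff.2 fun k => coeFn_truncE k u
  have hv : ∀ᵐ t ∂halfLine, ∀ k : ℕ, truncE k v t = (Iic ((k : ℝ≥0) : ℝ)).indicator v.1 t :=
    ae_all_iff.2 fun k => coeFn_truncE k v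
  filter_upwards [hu, hv] with t h1 h2
  obtain ⟨k, hk⟩ := exists_nat_ge t
  have hmem : t ∈ Iic ((k : ℝ≥0) : ℝ) := by simpa using hk
  have := (h1 k).symm.trans ((congrArg (fun w : L2 d => w t) (h k)).trans (h2 k))
  rwa [indicator_of_mem hmem, indicator_of_mem hmem] at this

theorem causalExt_toL2e {p q : ℕ} {R : L2 p → L2 q} (hR : Causal R) (u : L2 p) :
    causalExt R (toL2e u) = toL2e (R u) :=
  L2e_ext fun T => by
    rw [truncE_causalExt hR, truncE_toL2e, truncE_toL2e, ← hR]

theorem Causal.comp {p q s : ℕ} {S : L2 q → L2 s} {R : L2 p → L2 q} (hS : Causal S)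
    (hR : Causal R) : Causal fun u => S (R u) := fun T u => by
  rw [hS T (R u), hR T u, ← hS]

end Truncation

/-! ### From invertibility of `I + H₂ ∘ H₁` to the closed loop. -/

section Feedback

theorem wellPosedOn_univ_of_bijective {X Y : Type*} [AddCommGroup X] {H₁ : X → Y} {H₂ : Y → X}
    (h : Function.Bijective fun x => x + H₂ (H₁ x)) : WellPosedOn univ H₁ H₂ := by
  intro u _
  obtain ⟨e, he⟩ := h.2 u
  refine ⟨(e, H₁ e), ⟨eq_sub_of_add_eq he, rfl⟩, ?_⟩
  rintro ⟨e', y'⟩ ⟨h1, h2⟩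
  simp only at h1 h2
  subst h2
  have : e' = e := h.1 ((add_eq_of_eq_sub h1).trans he.symm)
  rw [this]

theorem feedback_eq_graph {X Y : Type*} [AddCommGroup X] {H₁ : X → Y} {H₂ : Y → X} {G : X → X}
    (h : Function.Injective fun x => x + H₂ (H₁ x)) (hG : ∀ u, G u + H₂ (H₁ (G u)) = u) :
    feedback H₁ H₂ = Function.graph fun u => H₁ (G u) := by
  ext ⟨u, y⟩
  constructor
  · rintro ⟨e, v, he, hv, hu⟩
    change H₁ e = y at he
    change H₂ y = v at hv
    change u = e + v at hu
    subst he hv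
    have : G u = e := h ((hG u).trans hu)
    change H₁ (G u) = H₁ e
    rw [this]
  · intro hy
    change H₁ (G u) = y at hy
    subst hy
    exact ⟨G u, H₂ (H₁ (G u)), rfl, rfl, (hG u).symm⟩

theorem incGain_le_of_mul_norm_sub_le {X Y : Type*} [NormedAddCommGroup X] [NormedAddCommGroup Y]
    {R : X → Y} {r : ℝ} (hr : 0 < r) (h : ∀ x y, r * ‖R x - R y‖ ≤ ‖x - y‖) :
    incGain R ≤ ENNReal.ofReal (1 / r) := by
  refine iSup_le fun x => iSup_le fun y => iSup_le fun _ => ENNReal.div_le_of_le_mul ?_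
  rw [← ofReal_norm, ← ofReal_norm, ← ENNReal.ofReal_mul (by positivity)]
  refine ENNReal.ofReal_le_ofReal ?_
  rw [one_div, ← div_eq_inv_mul, le_div_iff₀' hr]
  exact h x y

/-- The `L_2` solution also solves the extended equations. For any extended solution `e'`, causality
makes `P_T e'` solve the loop up to time `T`, so `hinj` identifies it with the `L_2` solution there.
-/
theorem wellPosedOn_causalExt {p q : ℕ} {H₁ : L2 p → L2 q} {H₂ : L2 q → L2 p}
    (hc₁ : Causal H₁) (hc₂ : Causal H₂)
    (hsurj : Function.Surjective fun x => x + H₂ (H₁ x))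
    (hinj : ∀ (T : ℝ≥0) (x y : L2 p),
      trunc T (x + H₂ (H₁ x)) = trunc T (y + H₂ (H₁ y)) → trunc T x = trunc T y) :
    WellPosedOn (range toL2e) (causalExt H₁) (causalExt H₂) := by
  rintro _ ⟨u, rfl⟩
  obtain ⟨e, he⟩ := hsurj u
  simp only at he
  have hadd : ∀ (T : ℝ≥0) (v w : L2 p), trunc T (v + w) = trunc T v + trunc T w :=
    fun T => map_add (truncₗ T)
  refine ⟨(toL2e e, toL2e (H₁ e)), ⟨?_, (causalExt_toL2e hc₁ e).symm⟩, ?_⟩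
  · simp only [causalExt_toL2e hc₂]
    refine L2e_ext fun T => ?_
    rw [truncE_sub, truncE_toL2e, truncE_toL2e, truncE_toL2e, ← he, hadd, add_sub_cancel_right]
  · rintro ⟨e', y'⟩ ⟨h1, h2⟩
    simp only at h1 h2
    subst h2
    have hee : e' = toL2e e := by
      refine L2e_ext fun T => ?_
      have h := congrArg (truncE T) h1
      rw [truncE_sub, truncE_causalExt hc₂, truncE_causalExt hc₁, ← hc₂, truncE_toL2e] at h
      have h' := hinj T (truncE T e') e (by
        rw [he, hadd, trunc_truncE le_rfl]
        exact add_eq_of_eq_sub h)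
      rwa [trunc_truncE le_rfl] at h'
    rw [hee, causalExt_toL2e hc₁]

end Feedback

end MimoSRG

theorem mainTheorem2 {p q n : ℕ} (hn : max p q ≤ n)
    (H₁ : MimoSRG.L2 p → MimoSRG.L2 q) (H₂ : MimoSRG.L2 q → MimoSRG.L2 p)
    (hchord : MimoSRG.ChordProperty (MimoSRG.SRG n H₁) ∨
      MimoSRG.ChordProperty (MimoSRG.SRG n H₂))
    (hrad₁ : MimoSRG.radius (MimoSRG.SRG n H₁) < ⊤)
    (hrad₂ : MimoSRG.radius (MimoSRG.SRG n H₂) < ⊤)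
    (r : ℝ) (hr : 0 < r)
    (hsep : ∀ τ : ℝ, 0 ≤ τ → τ ≤ 1 →
      ENNReal.ofReal r ≤ MimoSRG.setDist (MimoSRG.extInv '' MimoSRG.SRG n H₁)
        (MimoSRG.extScale (-τ) '' MimoSRG.SRG n H₂)) :
    MimoSRG.WellPosedOn Set.univ H₁ H₂ ∧
    ∃ R : MimoSRG.L2 p → MimoSRG.L2 q,
      MimoSRG.feedback H₁ H₂ = Function.graph R ∧
      MimoSRG.IncrementallyStable R ∧
      MimoSRG.incGain R ≤ ENNReal.ofReal (1 / r) ∧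
      (MimoSRG.Causal H₁ → MimoSRG.Causal H₂ →
        MimoSRG.Causal R ∧
        MimoSRG.WellPosedOn (Set.range MimoSRG.toL2e)
          (MimoSRG.causalExt H₁) (MimoSRG.causalExt H₂)) := by
  have hp : p ≤ n := (le_max_left p q).trans hn
  have hq : q ≤ n := (le_max_right p q).trans hn
  obtain ⟨L₁, hL₁, hlip₁⟩ := MimoSRG.exists_lipschitz_of_radius_lt_top hp hq hrad₁
  obtain ⟨L₂, hL₂, hlip₂⟩ := MimoSRG.exists_lipschitz_of_radius_lt_top hq hp hrad₂
  have hgain := fun (τ : ℝ) (h0 : 0 ≤ τ) (h1 : τ ≤ 1) =>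
    MimoSRG.mul_norm_sub_le_of_le_setDist hp hq h0 (hsep τ h0 h1)
  have hL : 0 ≤ L₂ * L₁ := mul_nonneg hL₂ hL₁
  -- Lipschitz constant for `(I + τK)⁻¹`: an increment `D` of `x + τ K x` gives an increment `D - τ
  -- ΔKx` of `x`, with `‖ΔKx‖ ≤ L₂ ‖D‖ / r`.
  have hC : 0 ≤ 1 + L₂ / r := by positivity
  have hK : ∀ x y, ‖H₂ (H₁ x) - H₂ (H₁ y)‖ ≤ L₂ * L₁ * ‖x - y‖ := fun x y =>
    (hlip₂ _ _).trans (by rw [mul_assoc]; exact mul_le_mul_of_nonneg_left (hlip₁ x y) hL₂)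
  have hinv : ∀ τ : ℝ, 0 ≤ τ → τ ≤ 1 → ∀ x y,
      ‖x - y‖ ≤ (1 + L₂ / r) * ‖(x + τ • H₂ (H₁ x)) - (y + τ • H₂ (H₁ y))‖ := by
    intro τ h0 h1 x y
    set D := (x + τ • H₂ (H₁ x)) - (y + τ • H₂ (H₁ y)) with hD
    have hg : ‖H₁ x - H₁ y‖ ≤ ‖D‖ / r := (le_div_iff₀' hr).2 (hgain τ h0 h1 x y)
    calc ‖x - y‖ = ‖D - τ • (H₂ (H₁ x) - H₂ (H₁ y))‖ := by rw [hD]; congr 1; module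
      _ ≤ ‖D‖ + τ * ‖H₂ (H₁ x) - H₂ (H₁ y)‖ := by
        refine (norm_sub_le _ _).trans_eq ?_
        rw [norm_smul, Real.norm_of_nonneg h0]
      _ ≤ ‖D‖ + 1 * (L₂ * (‖D‖ / r)) := by
        gcongr
        exact (hlip₂ _ _).trans (mul_le_mul_of_nonneg_left hg hL₂)
      _ = (1 + L₂ / r) * ‖D‖ := by ring
  have hsurj : Function.Surjective fun x => x + H₂ (H₁ x) := by
    simpa using MimoSRG.surjective_add_of_homotopy (K := fun x => H₂ (H₁ x)) hC hL hK hinv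
  have hinj : Function.Injective fun x => x + H₂ (H₁ x) := by
    intro x y hxy
    have h := hinv 1 zero_le_one le_rfl x y
    simp only at hxy
    rw [one_smul, one_smul, hxy, sub_self, norm_zero, mul_zero] at h
    exact sub_eq_zero.1 (norm_le_zero_iff.1 h)
  refine ⟨MimoSRG.wellPosedOn_univ_of_bijective ⟨hinj, hsurj⟩, ?_⟩
  choose G hG using hsurj
  simp only at hG
  have hΓ : MimoSRG.incGain (fun u => H₁ (G u)) ≤ ENNReal.ofReal (1 / r) :=
    MimoSRG.incGain_le_of_mul_norm_sub_le hr fun x y => by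
      simpa [hG] using hgain 1 zero_le_one le_rfl (G x) (G y)
  refine ⟨fun u => H₁ (G u), MimoSRG.feedback_eq_graph hinj hG,
    hΓ.trans_lt ENNReal.ofReal_lt_top, hΓ, fun hc₁ hc₂ => ?_⟩
  have hcaus : ∀ (T : ℝ≥0) (x y : MimoSRG.L2 p), MimoSRG.trunc T (x + H₂ (H₁ x)) =
      MimoSRG.trunc T (y + H₂ (H₁ y)) → MimoSRG.trunc T x = MimoSRG.trunc T y :=
    fun T x y => MimoSRG.proj_injective_add_of_homotopy (K := fun x => H₂ (H₁ x))
      (P := MimoSRG.truncₗ T) hC hL (MimoSRG.norm_trunc_le T) (MimoSRG.trunc_trunc T)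
      (hc₂.comp hc₁ T) hK hinv
  refine ⟨fun T u => ?_, MimoSRG.wellPosedOn_causalExt hc₁ hc₂ (fun u => ⟨G u, hG u⟩) hcaus⟩
  -- The inputs `u` and `P_T u` agree up to `T`, hence so do the loop errors `G u` and `G (P_T u)`.
  have h := hcaus T (G u) (G (MimoSRG.trunc T u)) (by rw [hG, hG, MimoSRG.trunc_trunc])
  change MimoSRG.trunc T (H₁ (G u)) = MimoSRG.trunc T (H₁ (G (MimoSRG.trunc T u)))
  rw [hc₁ T (G u), h, ← hc₁]
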